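/- Let $p$ be a prime and let $F$ be a field which contains a primitive $p$-th root of unity if $p$ is odd, and a primitive fourth root of unity if $p=2$. Let $G_F(p)$ be the maximal pro-$p$ quotient of the absolute Galois group $\mathrm{Gal}(F_{sep}/F)$. Let $$1\longrightarrow R\longrightarrow S\stackrel{\pi}{\longrightarrow} G_F(p)\longrightarrow 1$$ be a minimal presentation of $G_F(p)$, where $S$ is a free pro-$p$ group on a set of generators $\{x\}\sqcup\{y_i\mid i\in I\}$ converging to $1$ (that is, every neighbourhood of $1$ contains all but finitely many of the generators); minimality means that the images under $\pi$ of these generators form a minimal system of topological generators of $G_F(p)$ (no generator can be omitted). Let $T$ be the closed subgroup of $S$ generated by $\{y_i\}_{i\in I}$. Then there is no relation in $R$ of the form $x^{p^l u}s$, where $l$ and $u$ are nonzero integers with $l\ge 1$ and $\gcd(p,u)=1$, and $s\in T$. -/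

import Mathlib

open Filter Topology

universe v w

/-- The topological group `G` is a pro-`p` group: it is profinite (compact and totally disconnected)
and all its open normal subgroups have index a power of `p`. -/
structure IsProP (p : ℕ) (G : Type*) [Group G] [TopologicalSpace G] [IsTopologicalGroup G] :
    Prop where
  compact : CompactSpace G
  totallyDisconnected : TotallyDisconnectedSpace G
  index_eq_pow : ∀ U : Subgroup G, U.Normal → IsOpen (U : Set G) → ∃ n : ℕ, U.index = p ^ n

/-- The topological group `S` is the free pro-`p` group on the family `ι : X → S`, in the usual sense
of families converging to `1` (every neighbourhood of `1` contains all but finitely many members; no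
condition if `X` is finite): `S` is pro-`p`, the family `ι` converges to `1`, and every family
`f : X → P` converging to `1` in a pro-`p` group `P` extends uniquely to a continuous homomorphism
`S → P`. (As a pro-`p` group is determined by its finite quotients, and finite groups live in every
universe, it makes no difference that `P` ranges over the universe of `S`.) -/
structure IsFreeProP (p : ℕ) {X : Type v} {S : Type w} [Group S] [TopologicalSpace S]
    [IsTopologicalGroup S] (ι : X → S) : Prop where
  isProP : IsProP p S
  tendsto_one : Tendsto ι cofinite (𝓝 1)
  existsUnique_lift : ∀ (P : Type w) [Group P] [TopologicalSpace P] [IsTopologicalGroup P],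
    IsProP p P → ∀ f : X → P, Tendsto f cofinite (𝓝 1) →
      ∃! φ : S →ₜ* P, ∀ j : X, φ (ι j) = f j

/-- The closed subgroup of `G` (topologically) generated by the subset `A`. -/
def closedSubgroupClosure {G : Type*} [Group G] [TopologicalSpace G] [IsTopologicalGroup G]
    (A : Set G) : Subgroup G :=
  (Subgroup.closure A).topologicalClosure

/-- The family `g : X → G` is a minimal system of (topological) generators of `G`: it converges to
`1`, it generates `G` topologically, and it no longer does so when any of its members is omitted. -/
structure IsMinimalGeneratingSystem {X G : Type*} [Group G] [TopologicalSpace G]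
    [IsTopologicalGroup G] (g : X → G) : Prop where
  tendsto_one : Tendsto g cofinite (𝓝 1)
  generates : closedSubgroupClosure (Set.range g) = ⊤
  minimal : ∀ j : X, closedSubgroupClosure (g '' {j}ᶜ) ≠ ⊤

/-- The intersection of all open normal subgroups of `p`-power index, that is, the kernel of the
projection of the profinite group `G` onto its maximal pro-`p` quotient. -/
def maxProPKernel (p : ℕ) (G : Type*) [Group G] [TopologicalSpace G] : Subgroup G :=
  sInf {U : Subgroup G | U.Normal ∧ IsOpen (U : Set G) ∧ ∃ n : ℕ, U.index = p ^ n}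

instance maxProPKernel_normal (p : ℕ) (G : Type*) [Group G] [TopologicalSpace G] :
    (maxProPKernel p G).Normal where
  conj_mem a ha g := by
    unfold maxProPKernel at ha ⊢
    rw [Subgroup.mem_sInf] at ha ⊢
    intro U hU
    exact hU.1.conj_mem a (ha U hU) g

/-- The maximal pro-`p` quotient of the profinite group `G`, with the quotient topology. -/
abbrev MaxProPQuotient (p : ℕ) (G : Type*) [Group G] [TopologicalSpace G] : Type _ :=
  G ⧸ maxProPKernel p G

/-- `G_F(p)`: the maximal pro-`p` quotient of the absolute Galois group `Gal(F_sep / F)` (with its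
Krull topology). -/
abbrev GaloisProP (p : ℕ) (F : Type*) [Field F] : Type _ :=
  MaxProPQuotient p (SeparableClosure F ≃ₐ[F] SeparableClosure F)

/-- The family consisting of `x` and of all `y i`. -/
def adjoinFamily {I S : Type*} (x : S) (y : I → S) : Option I → S
  | none => x
  | some i => y i

/-- The continuous homomorphism `π : S → G` is a minimal presentation of `G` on the family
`ι : X → S`: `S` is the free pro-`p` group on `ι`, `π` is surjective, and `π` maps the free generators
to a minimal system of generators of `G`. Its group of relations is `R = ker π`. -/
structure IsMinimalPresentation (p : ℕ) {X : Type v} {S : Type w} {G : Type*} [Group S]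
    [TopologicalSpace S] [IsTopologicalGroup S] [Group G] [TopologicalSpace G]
    [IsTopologicalGroup G] (ι : X → S) (π : S →ₜ* G) : Prop where
  isFree : IsFreeProP p ι
  surjective : Function.Surjective π
  minimal : IsMinimalGeneratingSystem (π ∘ ι)

/-!
Put `N = maxProPKernel p Gal(E/F)`, where `E` is the separable closure of `F`, and lift the images
of the generators to `η k ∈ Gal(E/F)`. By Kummer theory, minimality yields, for every `j`, a `p`-th
root `α j` of an element of `F` that is moved by `η j` and fixed by all other `η k`. Given a
`p ^ n`-th root `β` of an element of `F` on which `η j` acts through a primitive `p ^ n`-th root of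
unity and which the other `η k` fix, choose `γ` with `γ ^ p = β`; each `η k`, `k ≠ j`, multiplies
`γ` by a `p`-th root of unity, almost always `1`, so dividing `γ` by suitable powers of the `α k`
makes it fixed by all of them. Hence such a `β` exists for every `n`.

The root of unity in `F` forces `σ ζ = ζ ^ k` with `k ≡ 1` modulo `p` (modulo `4` if `p = 2`) for
all roots of unity `ζ` of `p`-power order, so that `1 + k + ⋯ + k ^ (m - 1)` and `m` are divisible
by the same powers of `p`. It follows that the stabilizer of `β` contains `N`, and that `η j ^ m`
fixes `β` only if `p ^ n ∣ m`. As all `η k` with `k ≠ j` fix `β` for every `n`, no nonzero power of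
the `j`-th generator lies in the closed subgroup generated by the others.
-/

section ClosedSubgroupClosure

variable {G H : Type*} [Group G] [TopologicalSpace G] [IsTopologicalGroup G]
  [Group H] [TopologicalSpace H] [IsTopologicalGroup H] {A : Set G}

theorem subset_closedSubgroupClosure : A ⊆ closedSubgroupClosure A :=
  Subgroup.subset_closure.trans (Subgroup.le_topologicalClosure _)

theorem isClosed_closedSubgroupClosure : IsClosed (closedSubgroupClosure A : Set G) :=
  Subgroup.isClosed_topologicalClosure _

theorem closedSubgroupClosure_le {K : Subgroup G} (hK : IsClosed (K : Set G)) (hA : A ⊆ K) :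
    closedSubgroupClosure A ≤ K :=
  Subgroup.topologicalClosure_minimal _ ((Subgroup.closure_le _).2 hA) hK

theorem map_mem_closedSubgroupClosure_image (φ : G →ₜ* H) {s : G}
    (hs : s ∈ closedSubgroupClosure A) : φ s ∈ closedSubgroupClosure (φ '' A) :=
  closedSubgroupClosure_le (K := (closedSubgroupClosure (φ '' A)).comap (φ : G →* H))
    (isClosed_closedSubgroupClosure.preimage φ.continuous_toFun)
    (fun a ha => subset_closedSubgroupClosure ⟨a, ha, rfl⟩) hs

end ClosedSubgroupClosure

section FinitePGroup

variable {p : ℕ} [hp : Fact p.Prime]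

theorem exists_index_inf_eq_pow {Γ : Type*} [Group Γ] {U V : Subgroup Γ} [V.Normal]
    (hU : ∃ n : ℕ, U.index = p ^ n) (hV : ∃ n : ℕ, V.index = p ^ n) :
    ∃ n : ℕ, (U ⊓ V).index = p ^ n := by
  obtain ⟨a, ha⟩ := hU
  obtain ⟨b, hb⟩ := hV
  obtain ⟨c, -, hc⟩ := (Nat.dvd_prime_pow hp.out).1 (hb ▸ Subgroup.relIndex_dvd_index_of_normal V U)
  refine ⟨c + a, ?_⟩
  rw [← Subgroup.relIndex_mul_index (inf_le_left : U ⊓ V ≤ U), Subgroup.inf_relIndex_left, hc, ha,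
    pow_add]

theorem exists_normal_index_eq_prime_ge {Q : Type*} [Group Q] [Finite Q] (hQ : IsPGroup p Q)
    {H : Subgroup Q} (hH : H ≠ ⊤) : ∃ K : Subgroup Q, K.Normal ∧ K.index = p ∧ H ≤ K := by
  obtain ⟨n, hn⟩ := IsPGroup.iff_card.1 hQ
  obtain ⟨m, hmn, hm⟩ := (Nat.dvd_prime_pow hp.out).1 (hn ▸ Subgroup.card_subgroup_dvd_card H)
  have hlt : m < n := hmn.lt_of_ne fun h => hH (Subgroup.eq_top_of_card_eq H (by rw [hm, hn, h]))
  obtain ⟨k, rfl⟩ := Nat.exists_eq_add_one_of_ne_zero (Nat.ne_zero_of_lt hlt)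
  obtain ⟨K, hK, hHK⟩ := Sylow.exists_subgroup_card_pow_prime_le p
    (hn ▸ pow_dvd_pow p k.le_succ) H hm (Nat.lt_succ_iff.1 hlt)
  have hindex : K.index = p := by
    have h := K.card_mul_index
    rw [hK, hn, pow_succ] at h
    exact Nat.eq_of_mul_eq_mul_left (pow_pos hp.out.pos k) h
  refine ⟨K, Subgroup.normal_of_index_eq_minFac_card ?_, hindex, hHK⟩
  rw [hindex, hn, hp.out.pow_minFac k.succ_ne_zero]

end FinitePGroup

section MaxProPKernel

variable {p : ℕ} [hp : Fact p.Prime] {Γ : Type*} [Group Γ]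

theorem mk_mem_map_mk_iff {N U : Subgroup Γ} [N.Normal] (hN : N ≤ U) {σ : Γ} :
    (σ : Γ ⧸ N) ∈ U.map (QuotientGroup.mk' N) ↔ σ ∈ U := by
  rw [← QuotientGroup.mk'_apply, ← Subgroup.mem_comap,
    Subgroup.comap_map_eq_self ((QuotientGroup.ker_mk' N).trans_le hN)]

variable [TopologicalSpace Γ] [IsTopologicalGroup Γ]

theorem isOpen_map_mk (N : Subgroup Γ) [N.Normal] {U : Subgroup Γ} (hU : IsOpen (U : Set Γ)) :
    IsOpen (U.map (QuotientGroup.mk' N) : Set (Γ ⧸ N)) :=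
  QuotientGroup.isOpenMap_coe _ hU

theorem closedSubgroupClosure_image_mk_le_map {N U : Subgroup Γ} [N.Normal]
    (hU : IsOpen (U : Set Γ)) {X : Type*} {s : Set X} {η : X → Γ} (hη : ∀ k ∈ s, η k ∈ U) :
    closedSubgroupClosure ((fun k => (η k : Γ ⧸ N)) '' s) ≤ U.map (QuotientGroup.mk' N) := by
  refine closedSubgroupClosure_le (Subgroup.isClosed_of_isOpen _ (isOpen_map_mk N hU)) ?_
  rintro _ ⟨k, hk, rfl⟩
  exact ⟨η k, hη k hk, rfl⟩

theorem finite_setOf_notMem_of_tendsto_mk {N U : Subgroup Γ} [N.Normal] (hN : N ≤ U)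
    (hU : IsOpen (U : Set Γ)) {X : Type*} {η : X → Γ}
    (hη : Tendsto (fun k => (η k : Γ ⧸ N)) cofinite (𝓝 1)) : {k | η k ∉ U}.Finite := by
  have h : ∀ᶠ k in cofinite, (η k : Γ ⧸ N) ∈ U.map (QuotientGroup.mk' N) :=
    hη.eventually ((isOpen_map_mk N hU).mem_nhds (Subgroup.one_mem _))
  simpa only [mk_mem_map_mk_iff hN] using eventually_cofinite.1 h

theorem exists_open_normal_index_eq_pow_subset [CompactSpace Γ] {O : Set Γ} (hO : IsOpen O)
    (hN : (maxProPKernel p Γ : Set Γ) ⊆ O) :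
    ∃ U : Subgroup Γ, U.Normal ∧ IsOpen (U : Set Γ) ∧ (∃ n : ℕ, U.index = p ^ n) ∧
      (U : Set Γ) ⊆ O := by
  let J := {U : Subgroup Γ // U.Normal ∧ IsOpen (U : Set Γ) ∧ ∃ n : ℕ, U.index = p ^ n}
  have : Nonempty J := ⟨⟨⊤, inferInstance, isOpen_univ, 0, by simp⟩⟩
  have hdir : Directed (· ⊇ ·) fun U : J => (U.1 : Set Γ) := by
    rintro ⟨U, hUn, hUo, hUi⟩ ⟨V, hVn, hVo, hVi⟩
    exact ⟨⟨U ⊓ V, inferInstance, hUo.inter hVo, exists_index_inf_eq_pow hUi hVi⟩,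
      Set.inter_subset_left, Set.inter_subset_right⟩
  obtain ⟨⟨U, hUn, hUo, hUi⟩, hU⟩ := exists_subset_nhds_of_compactSpace hdir
    (fun U => U.1.isClosed_of_isOpen U.2.2.1) fun σ hσ => hO.mem_nhds <| hN <|
      Subgroup.mem_sInf.2 fun U hU => Set.mem_iInter.1 hσ ⟨U, hU⟩
  exact ⟨U, hUn, hUo, hUi, hU⟩

theorem exists_open_normal_index_eq_prime_ge [CompactSpace Γ] {H : Subgroup Γ}
    (hc : IsClosed (H : Set Γ)) (hN : maxProPKernel p Γ ≤ H) (hH : H ≠ ⊤) :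
    ∃ M : Subgroup Γ, M.Normal ∧ IsOpen (M : Set Γ) ∧ M.index = p ∧ H ≤ M := by
  obtain ⟨g, hg⟩ : ∃ g, g ∉ H := by
    by_contra! h
    exact hH ((Subgroup.eq_top_iff' H).2 h)
  obtain ⟨U, hUn, hUo, ⟨n, hUi⟩, hU⟩ := exists_open_normal_index_eq_pow_subset
    (hc.isOpen_compl.preimage (continuous_const_mul g))
    fun σ hσ hgσ => hg ((H.mul_mem_cancel_right (hN hσ)).1 hgσ)
  have : Finite (Γ ⧸ U) := U.quotient_finite_of_isOpen hUo
  have hmap : H.map (QuotientGroup.mk' U) ≠ ⊤ := fun h => by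
    obtain ⟨x, hx, hxg⟩ := (Subgroup.eq_top_iff' _).1 h (QuotientGroup.mk' U g)
    have hgx : g⁻¹ * x ∈ U := QuotientGroup.eq.1 hxg.symm
    exact hU hgx (by simpa using hx)
  obtain ⟨K, hKn, hKi, hHK⟩ := exists_normal_index_eq_prime_ge (IsPGroup.of_card hUi) hmap
  refine ⟨K.comap (QuotientGroup.mk' U), inferInstance, ?_, ?_, Subgroup.map_le_iff_le_comap.1 hHK⟩
  · refine Subgroup.isOpen_mono ?_ hUo
    simpa only [QuotientGroup.ker_mk'] using (QuotientGroup.mk' U).ker_le_comap K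
  · rw [Subgroup.index_comap_of_surjective _ (QuotientGroup.mk'_surjective U), hKi]

theorem maxProPKernel_le_of_forall_pow_mem [CompactSpace Γ] {H : Subgroup Γ}
    (hH : IsOpen (H : Set Γ)) {m : ℕ} (hpow : ∀ σ : Γ, σ ^ p ^ m ∈ H) :
    maxProPKernel p Γ ≤ H := by
  have : Finite (Γ ⧸ H) := H.quotient_finite_of_isOpen hH
  have : H.FiniteIndex := Subgroup.finiteIndex_of_finite_quotient
  have hopen : IsOpen (H.normalCore : Set Γ) := Subgroup.isOpen_of_isClosed_of_finiteIndex _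
    (H.normalCore_isClosed (H.isClosed_of_isOpen hH))
  have hpgroup : IsPGroup p (Γ ⧸ H.normalCore) := by
    rintro ⟨σ⟩
    refine ⟨m, (QuotientGroup.eq_one_iff _).2 fun τ => ?_⟩
    rw [← conj_pow]
    exact hpow _
  have hmem : maxProPKernel p Γ ≤ H.normalCore :=
    sInf_le ⟨inferInstance, hopen, IsPGroup.iff_card.1 hpgroup⟩
  exact hmem.trans H.normalCore_le

end MaxProPKernel

section Arithmetic

theorem isPrimitiveRoot_pow_pow_sub_one {p : ℕ} [NeZero p] {M : Type*} [CommMonoid M] {w : M}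
    {c : ℕ} (hw : IsPrimitiveRoot w (p ^ c)) (hc : c ≠ 0) :
    IsPrimitiveRoot (w ^ p ^ (c - 1)) p :=
  hw.pow (NeZero.pos _) (pow_sub_one_mul hc p).symm

variable {p : ℕ} [hp : Fact p.Prime]

theorem isPrimitiveRoot_pow_succ_of_pow {M : Type*} [CommMonoid M] {ζ : M} {n : ℕ}
    (h : IsPrimitiveRoot (ζ ^ p) (p ^ (n + 1))) : IsPrimitiveRoot ζ (p ^ (n + 1 + 1)) := by
  rw [IsPrimitiveRoot.iff_orderOf]
  refine orderOf_eq_prime_pow (fun hζ => ?_) ?_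
  · rw [pow_succ', pow_mul] at hζ
    exact h.pow_ne_one_of_pos_of_lt (pow_ne_zero _ hp.out.ne_zero)
      (Nat.pow_lt_pow_right hp.out.one_lt n.lt_succ_self) hζ
  · rw [pow_succ', pow_mul, h.pow_eq_one]

/-- The hypotheses are those for lifting the exponent: `p ∣ k - 1`, and `4 ∣ k - 1` if `p = 2`. -/
theorem pow_dvd_geom_sum_iff {c k : ℕ} (hc : 2 < p ^ c) (hk : 1 ≡ k [MOD p ^ c]) (a m : ℕ) :
    p ^ a ∣ ∑ i ∈ Finset.range m, k ^ i ↔ p ^ a ∣ m := by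
  have hprime : Prime (p : ℤ) := Nat.prime_iff_prime_int.1 hp.out
  have hdvd : (p : ℤ) ^ c ∣ k - 1 := by exact_mod_cast hk.dvd
  have hc0 : c ≠ 0 := by
    rintro rfl
    simp at hc
  have hpk1 : (p : ℤ) ∣ k - 1 := (dvd_pow_self _ hc0).trans hdvd
  have hpk : ¬ (p : ℤ) ∣ k := fun h => hprime.not_dvd_one ((dvd_sub_right h).1 hpk1)
  rcases eq_or_ne k 1 with rfl | hk1
  · simp
  have key : emultiplicity (p : ℤ) ((k : ℤ) ^ m - 1 ^ m) =
      emultiplicity (p : ℤ) (k - 1) + emultiplicity (p : ℤ) (m : ℤ) := by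
    rcases hp.out.eq_two_or_odd' with rfl | hodd
    · have hc2 : 2 ≤ c := (Nat.pow_lt_pow_iff_right one_lt_two).1 (by simpa using hc)
      exact Int.two_pow_sub_pow' m ((pow_dvd_pow 2 hc2).trans hdvd) hpk
    · rw [Int.emultiplicity_pow_sub_pow hp.out hodd hpk1 hpk, Int.natCast_emultiplicity]
  have hfin : FiniteMultiplicity (p : ℤ) (k - 1) :=
    Int.finiteMultiplicity_iff.2 ⟨by simpa using hp.out.ne_one, by
      rwa [sub_ne_zero, Nat.cast_ne_one]⟩
  rw [one_pow, ← mul_geom_sum, emultiplicity_mul hprime] at key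
  have hsum := ENat.add_right_injective_of_ne_top
    (finiteMultiplicity_iff_emultiplicity_ne_top.1 hfin) key
  zify
  rw [pow_dvd_iff_le_emultiplicity, hsum, ← pow_dvd_iff_le_emultiplicity]

end Arithmetic

section Kummer

variable {F E : Type*} [Field F] [Field E] [Algebra F E]

theorem apply_div_self_pow_eq_one {q : ℕ} {β : E} (hβ0 : β ≠ 0)
    (hβ : β ^ q ∈ Set.range (algebraMap F E)) (σ : Gal(E/F)) : (σ β / β) ^ q = 1 := by
  obtain ⟨b, hb⟩ := hβ
  rw [div_pow, ← map_pow, ← hb, AlgEquiv.commutes, hb, div_self (pow_ne_zero _ hβ0)]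

theorem pow_apply_eq_pow_geom_sum_mul {ζ β : E} {σ : Gal(E/F)} {k : ℕ} (hζ : σ ζ = ζ ^ k)
    (hβ : σ β = ζ * β) (m : ℕ) : (σ ^ m) β = ζ ^ (∑ i ∈ Finset.range m, k ^ i) * β := by
  induction m with
  | zero => simp
  | succ m ih =>
    rw [pow_succ', AlgEquiv.mul_apply, ih, map_mul, map_pow, hζ, hβ, geom_sum_succ, pow_succ,
      pow_mul, mul_assoc]

theorem fixingSubgroup_adjoin_simple (α : E) :
    (IntermediateField.adjoin F {α}).fixingSubgroup = MulAction.stabilizer Gal(E/F) α := by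
  ext σ
  simpa [IntermediateField.mem_fixingSubgroup_iff] using
    IntermediateField.forall_mem_adjoin_smul_eq_self_iff F (S := {α}) σ

/-- Kummer theory: the fixed field of `M` is a cyclic extension of `F` of degree `p`. -/
theorem exists_pow_mem_stabilizer_eq [IsGalois F E] {p : ℕ} [hp : Fact p.Prime] {z : F}
    (hz : IsPrimitiveRoot z p) {M : Subgroup Gal(E/F)} [hn : M.Normal]
    (ho : IsOpen (M : Set Gal(E/F))) (hi : M.index = p) :
    ∃ α : E, α ^ p ∈ Set.range (algebraMap F E) ∧ MulAction.stabilizer Gal(E/F) α = M := by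
  let H : ClosedSubgroup Gal(E/F) := ⟨M, M.isClosed_of_isOpen ho⟩
  have : H.Normal := hn
  let L := IntermediateField.fixedField M
  have hfix : L.fixingSubgroup = M := InfiniteGalois.fixingSubgroup_fixedField H
  obtain ⟨_, _⟩ := (InfiniteGalois.isOpen_and_normal_iff_finite_and_isGalois L).1
    (by rw [hfix]; exact ⟨ho, hn⟩)
  have hcard : Nat.card Gal(L/F) = p := by
    rw [← hi, Subgroup.index_eq_card]
    exact (Nat.card_congr (InfiniteGalois.normalAutEquivQuotient H).toEquiv).symm
  have hrank : Module.finrank F L = p := by rw [← IsGalois.card_aut_eq_finrank, hcard]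
  have : IsCyclic Gal(L/F) := isCyclic_of_prime_card hcard
  obtain ⟨α, ⟨a, ha⟩, htop⟩ := exists_root_adjoin_eq_top_of_isCyclic F L
    ⟨z, by rwa [hrank, mem_primitiveRoots hp.out.pos]⟩
  have hL : IntermediateField.adjoin F {(α : E)} = L := by
    rw [← IntermediateField.lift_adjoin_simple, htop, IntermediateField.lift_top]
  refine ⟨α, ⟨a, ?_⟩, by rw [← fixingSubgroup_adjoin_simple, hL, hfix]⟩
  rw [hrank] at ha
  simpa using congrArg (algebraMap L E) ha

end Kummer

section CyclotomicAction

variable {F E : Type*} [Field F] [Field E] [Algebra F E]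

theorem exists_apply_eq_pow_modEq_one {p : ℕ} [NeZero p] {c : ℕ} {w : F}
    (hw : IsPrimitiveRoot w (p ^ c)) {a : ℕ} {ζ : E} (hζ : IsPrimitiveRoot ζ (p ^ a))
    (σ : Gal(E/F)) : ∃ k : ℕ, σ ζ = ζ ^ k ∧ 1 ≡ k [MOD p ^ c] := by
  have hw' := hw.map_of_injective (algebraMap F E).injective
  have hfixed : ∀ ξ : E, ξ ^ p ^ c = 1 → σ ξ = ξ := fun ξ hξ => by
    obtain ⟨i, -, rfl⟩ := hw'.eq_pow_of_pow_eq_one hξ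
    rw [map_pow, AlgEquiv.commutes]
  rcases le_total a c with hac | hca
  · refine ⟨1, ?_, rfl⟩
    rw [pow_one, hfixed ζ ((hζ.pow_eq_one_iff_dvd _).2 (pow_dvd_pow p hac))]
  · obtain ⟨k, -, hk⟩ := hζ.eq_pow_of_pow_eq_one (ξ := σ ζ) (by
      rw [← map_pow, hζ.pow_eq_one, map_one])
    obtain ⟨b, rfl⟩ := Nat.exists_eq_add_of_le' hca
    have hξ : IsPrimitiveRoot (ζ ^ p ^ b) (p ^ c) := hζ.pow (NeZero.pos _) (pow_add p b c)
    refine ⟨k, hk.symm, ?_⟩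
    rw [hξ.eq_orderOf, ← (hξ.isOfFinOrder (NeZero.ne _)).pow_eq_pow_iff_modEq, pow_one,
      pow_right_comm, hk, ← map_pow, hfixed _ hξ.pow_eq_one]

variable {p : ℕ} [hp : Fact p.Prime] {c : ℕ} {w : F} (hw : IsPrimitiveRoot w (p ^ c))
  (hc : 2 < p ^ c)

include hw hc

theorem pow_mem_stabilizer_iff {a : ℕ} {β : E} (hβ : β ≠ 0) {σ : Gal(E/F)}
    (hσ : IsPrimitiveRoot (σ β / β) (p ^ a)) (m : ℕ) :
    σ ^ m ∈ MulAction.stabilizer Gal(E/F) β ↔ p ^ a ∣ m := by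
  obtain ⟨k, hk, hk1⟩ := exists_apply_eq_pow_modEq_one hw hσ σ
  rw [MulAction.mem_stabilizer_iff, AlgEquiv.smul_def,
    pow_apply_eq_pow_geom_sum_mul hk (div_mul_cancel₀ _ hβ).symm, mul_eq_right₀ hβ,
    hσ.pow_eq_one_iff_dvd, pow_dvd_geom_sum_iff hc hk1]

theorem maxProPKernel_le_stabilizer [IsGalois F E] {n : ℕ} {β : E} (hβ0 : β ≠ 0)
    (hβ : β ^ p ^ n ∈ Set.range (algebraMap F E)) :
    maxProPKernel p Gal(E/F) ≤ MulAction.stabilizer Gal(E/F) β := by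
  refine maxProPKernel_le_of_forall_pow_mem (m := n) (stabilizer_isOpen_of_isIntegral β) fun σ => ?_
  obtain ⟨a, han, ha⟩ := (Nat.dvd_prime_pow hp.out).1
    (orderOf_dvd_of_pow_eq_one (apply_div_self_pow_eq_one hβ0 hβ σ))
  exact (pow_mem_stabilizer_iff hw hc hβ0 (ha ▸ IsPrimitiveRoot.orderOf _) _).2
    (pow_dvd_pow p han)

end CyclotomicAction

/-- A `q`-th root `β` of an element of `F` is dual to the member `η j` of the family `η` if `η j`
acts on it through a primitive `q`-th root of unity and all other members of `η` fix it. Under the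
Kummer pairing `(σ, β) ↦ σ β / β` such roots play the role of a dual basis of `η`. -/
structure IsDualRoot {F E X : Type*} [Field F] [Field E] [Algebra F E] (η : X → Gal(E/F)) (j : X)
    (q : ℕ) (β : E) : Prop where
  ne_zero : β ≠ 0
  pow_mem_range : β ^ q ∈ Set.range (algebraMap F E)
  apply_eq_self : ∀ k, k ≠ j → η k β = β
  isPrimitiveRoot : IsPrimitiveRoot (η j β / β) q

section DualRoots

variable {F E X : Type*} [Field F] [Field E] [Algebra F E] {p : ℕ} [hp : Fact p.Prime]
  {η : X → Gal(E/F)}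

theorem IsMinimalGeneratingSystem.exists_isDualRoot [IsGalois F E] {z : F}
    (hz : IsPrimitiveRoot z p)
    (hη : IsMinimalGeneratingSystem fun k => (η k : MaxProPQuotient p Gal(E/F))) (j : X) :
    ∃ α : E, IsDualRoot η j p α := by
  let N := maxProPKernel p Gal(E/F)
  let C := closedSubgroupClosure ((fun k => (η k : Gal(E/F) ⧸ N)) '' {j}ᶜ)
  have hN : N ≤ C.comap (QuotientGroup.mk' N) := by
    simpa only [QuotientGroup.ker_mk'] using (QuotientGroup.mk' N).ker_le_comap C
  have hC : C.comap (QuotientGroup.mk' N) ≠ ⊤ := fun h =>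
    hη.minimal j (Subgroup.comap_injective (QuotientGroup.mk'_surjective N)
      (h.trans (Subgroup.comap_top _).symm))
  obtain ⟨M, hMn, hMo, hMi, hM⟩ := exists_open_normal_index_eq_prime_ge
    (isClosed_closedSubgroupClosure.preimage QuotientGroup.continuous_mk) hN hC
  obtain ⟨α, hα, rfl⟩ := exists_pow_mem_stabilizer_eq hz hMo hMi
  have hfix : ∀ k, k ≠ j → η k α = α := fun k hk =>
    hM (subset_closedSubgroupClosure ⟨k, hk, rfl⟩ : η k ∈ C.comap (QuotientGroup.mk' N))
  have hmoved : η j α ≠ α := fun hj => by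
    have hle := closedSubgroupClosure_image_mk_le_map (N := N) (s := Set.univ) hMo fun k _ => by
      by_cases hk : k = j
      · exact hk ▸ hj
      · exact hfix k hk
    rw [Set.image_univ, hη.generates] at hle
    have htop : MulAction.stabilizer Gal(E/F) α = ⊤ := (Subgroup.eq_top_iff' _).2 fun σ =>
      (mk_mem_map_mk_iff (hN.trans hM)).1 (hle (Subgroup.mem_top (σ : Gal(E/F) ⧸ N)))
    rw [htop, Subgroup.index_top] at hMi
    exact hp.out.ne_one hMi.symm
  have hα0 : α ≠ 0 := by
    rintro rfl
    exact hmoved (map_zero _)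
  exact ⟨α, hα0, hα, hfix, IsPrimitiveRoot.iff_orderOf.2 <| orderOf_eq_prime
    (apply_div_self_pow_eq_one hα0 hα _) fun h => hmoved ((div_eq_one_iff_eq hα0).1 h)⟩

theorem exists_apply_eq_mul_of_isDualRoot {q : ℕ} [NeZero q]
    (hdual : ∀ j, ∃ α : E, IsDualRoot η j q α) {ξ : X → E}
    (hξ : ∀ k, ξ k ^ q = 1) (hfin : {k | ξ k ≠ 1}.Finite) :
    ∃ α : E, α ≠ 0 ∧ α ^ q ∈ Set.range (algebraMap F E) ∧ ∀ k, η k α = ξ k * α := by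
  classical
  choose α hα using hdual
  choose e _ he using fun j => (hα j).isPrimitiveRoot.eq_pow_of_pow_eq_one (hξ j)
  have happly : ∀ k j, η k (α j ^ e j) = Pi.mulSingle (M := fun _ => E) j (ξ j) k * α j ^ e j := by
    intro k j
    rcases eq_or_ne k j with rfl | hkj
    · rw [Pi.mulSingle_eq_same, ← he, div_pow, map_pow,
        div_mul_cancel₀ _ (pow_ne_zero _ (hα k).ne_zero)]
    · rw [Pi.mulSingle_eq_of_ne hkj, one_mul, map_pow, (hα j).apply_eq_self k hkj]
  refine ⟨∏ j ∈ hfin.toFinset, α j ^ e j, ?_, ?_, fun k => ?_⟩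
  · exact Finset.prod_ne_zero_iff.2 fun j _ => pow_ne_zero _ (hα j).ne_zero
  · rw [← Finset.prod_pow, ← RingHom.coe_range]
    refine prod_mem fun j _ => ?_
    rw [pow_right_comm]
    exact pow_mem (hα j).pow_mem_range _
  · rw [map_prod, Finset.prod_congr rfl fun j _ => happly k j, Finset.prod_mul_distrib,
      Finset.prod_pi_mulSingle]
    congr 1
    simpa using Eq.symm

variable [IsGalois F E] {c : ℕ} {w : F} (hw : IsPrimitiveRoot w (p ^ c)) (hc : 2 < p ^ c)
  (htendsto : Tendsto (fun k => (η k : MaxProPQuotient p Gal(E/F))) cofinite (𝓝 1))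
  (hdual : ∀ j, ∃ α : E, IsDualRoot η j p α)

include hw hc htendsto hdual

theorem IsDualRoot.exists_pow_succ {j : X} {n : ℕ} {γ : E}
    (hγ : IsDualRoot η j (p ^ (n + 1)) (γ ^ p)) :
    ∃ δ : E, IsDualRoot η j (p ^ (n + 1 + 1)) δ := by
  classical
  have hγ0 : γ ≠ 0 := fun h => hγ.ne_zero (by rw [h, zero_pow hp.out.ne_zero])
  have hγmem : γ ^ p ^ (n + 1 + 1) ∈ Set.range (algebraMap F E) := by
    rw [pow_succ', pow_mul]
    exact hγ.pow_mem_range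
  let ξ : X → E := Function.update (fun k => η k γ / γ) j 1
  have hξj : ξ j = 1 := Function.update_self ..
  have hξ_of_ne : ∀ k, k ≠ j → ξ k = η k γ / γ := fun k hk => Function.update_of_ne hk ..
  have hξ : ∀ k, ξ k ^ p = 1 := fun k => by
    rcases eq_or_ne k j with rfl | hk
    · rw [hξj, one_pow]
    · rw [hξ_of_ne k hk, div_pow, ← map_pow, hγ.apply_eq_self k hk, div_self hγ.ne_zero]
  have hfin : {k | ξ k ≠ 1}.Finite := by
    refine (finite_setOf_notMem_of_tendsto_mk (maxProPKernel_le_stabilizer hw hc hγ0 hγmem)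
      (stabilizer_isOpen_of_isIntegral γ) htendsto).subset fun k hk hfix => hk ?_
    rcases eq_or_ne k j with rfl | hkj
    · exact hξj
    · rw [hξ_of_ne k hkj, div_eq_one_iff_eq hγ0]
      exact hfix
  obtain ⟨α, hα0, hα, hηα⟩ := exists_apply_eq_mul_of_isDualRoot hdual hξ hfin
  refine ⟨γ / α, div_ne_zero hγ0 hα0, ?_, fun k hk => ?_, ?_⟩
  · rw [div_pow]
    refine (algebraMap F E).fieldRange.div_mem hγmem ?_
    rw [pow_succ', pow_mul]
    exact (algebraMap F E).fieldRange.pow_mem hα _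
  · rw [map_div₀, hηα, hξ_of_ne k hk]
    have hηγ0 : η k γ ≠ 0 := (map_ne_zero _).2 hγ0
    field_simp
  · rw [map_div₀, hηα, hξj, one_mul, div_div_div_cancel_right₀ hα0]
    refine isPrimitiveRoot_pow_succ_of_pow ?_
    simpa only [div_pow, map_pow] using hγ.isPrimitiveRoot

theorem exists_isDualRoot_pow (hroot : ∀ β : E, ∃ γ, γ ^ p = β) (j : X) (n : ℕ) :
    ∃ β : E, IsDualRoot η j (p ^ (n + 1)) β := by
  induction n with
  | zero => simpa only [zero_add, pow_one] using hdual j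
  | succ n ih =>
    obtain ⟨β, hβ⟩ := ih
    obtain ⟨γ, rfl⟩ := hroot β
    exact hβ.exists_pow_succ hw hc htendsto hdual

end DualRoots

theorem IsMinimalGeneratingSystem.zpow_notMem {F E X : Type*} [Field F] [Field E] [Algebra F E]
    [IsGalois F E] {p : ℕ} [hp : Fact p.Prime] {c : ℕ} {w : F} (hw : IsPrimitiveRoot w (p ^ c))
    (hc : 2 < p ^ c) (hroot : ∀ β : E, ∃ γ, γ ^ p = β) {g : X → MaxProPQuotient p Gal(E/F)}
    (hg : IsMinimalGeneratingSystem g) (j : X) {m : ℤ} (hm : m ≠ 0) :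
    g j ^ m ∉ closedSubgroupClosure (g '' {j}ᶜ) := by
  intro hmem
  obtain ⟨η, rfl⟩ : ∃ η : X → Gal(E/F), (fun k => (η k : MaxProPQuotient p Gal(E/F))) = g :=
    (QuotientGroup.mk_surjective (s := maxProPKernel p Gal(E/F))).comp_left g
  have hz := isPrimitiveRoot_pow_pow_sub_one hw fun h => by simp [h] at hc
  obtain ⟨β, hβ⟩ := exists_isDualRoot_pow hw hc hg.tendsto_one (hg.exists_isDualRoot hz) hroot j
    m.natAbs
  have hstab : η j ^ m ∈ MulAction.stabilizer Gal(E/F) β :=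
    (mk_mem_map_mk_iff (maxProPKernel_le_stabilizer hw hc hβ.ne_zero hβ.pow_mem_range)).1 <|
      closedSubgroupClosure_image_mk_le_map (stabilizer_isOpen_of_isIntegral β)
        hβ.apply_eq_self hmem
  have hstab_natAbs : η j ^ m.natAbs ∈ MulAction.stabilizer Gal(E/F) β := by
    rw [← zpow_natCast]
    rcases Int.natAbs_eq m with h | h
    · rwa [← h]
    · rwa [← Subgroup.inv_mem_iff, ← zpow_neg, ← h]
  have hdvd := (pow_mem_stabilizer_iff hw hc hβ.ne_zero hβ.isPrimitiveRoot _).1 hstab_natAbs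
  have hle := Nat.le_of_dvd (Int.natAbs_pos.2 hm) hdvd
  exact hle.not_gt ((Nat.lt_succ_self _).trans (Nat.lt_pow_self hp.out.one_lt))

theorem exists_isPrimitiveRoot_pow_two_lt {p : ℕ} (hp : p.Prime) {F : Type*} [Field F]
    (hodd : p ≠ 2 → ∃ ζ : F, IsPrimitiveRoot ζ p)
    (htwo : p = 2 → ∃ ζ : F, IsPrimitiveRoot ζ 4) :
    ∃ (c : ℕ) (w : F), IsPrimitiveRoot w (p ^ c) ∧ 2 < p ^ c := by
  rcases eq_or_ne p 2 with rfl | h2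
  · obtain ⟨w, hw⟩ := htwo rfl
    exact ⟨2, w, hw, by norm_num⟩
  · obtain ⟨w, hw⟩ := hodd h2
    exact ⟨1, w, by rwa [pow_one], by simpa using hp.two_le.lt_of_ne' h2⟩

theorem adjoinFamily_image_compl_none {I S : Type*} (x : S) (y : I → S) :
    adjoinFamily x y '' {none}ᶜ = Set.range y := by
  rw [← Set.compl_range_some, compl_compl, ← Set.range_comp]
  rfl

theorem theorem3p8_general {p : ℕ} (hp : p.Prime) {F : Type*} [Field F]
    (hodd : p ≠ 2 → ∃ ζ : F, IsPrimitiveRoot ζ p)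
    (htwo : p = 2 → ∃ ζ : F, IsPrimitiveRoot ζ 4)
    {S : Type*} [Group S] [TopologicalSpace S] [IsTopologicalGroup S]
    {X : Type*} {ι : X → S} {π : S →ₜ* GaloisProP p F} (hπ : IsMinimalGeneratingSystem (π ∘ ι))
    (j : X) {m : ℤ} (hm : m ≠ 0) {s : S} (hs : s ∈ closedSubgroupClosure (ι '' {j}ᶜ)) :
    ι j ^ m * s ∉ (π : S →* GaloisProP p F).ker := by
  have := Fact.mk hp
  obtain ⟨c, w, hw, hc⟩ := exists_isPrimitiveRoot_pow_two_lt hp hodd htwo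
  have : NeZero (p : SeparableClosure F) :=
    (isPrimitiveRoot_pow_pow_sub_one (hw.map_of_injective (algebraMap F _).injective)
      fun h => by simp [h] at hc).neZero'
  intro hker
  have hrel : π (ι j) ^ m * π s = 1 := by
    rw [← map_zpow, ← map_mul]
    exact hker
  refine hπ.zpow_notMem hw hc (fun β => IsSepClosed.exists_pow_nat_eq β p) j hm ?_
  rw [Set.image_comp, Function.comp_apply, eq_inv_of_mul_eq_one_left hrel]
  exact inv_mem (map_mem_closedSubgroupClosure_image π hs)

theorem theorem3p8 {p : ℕ} (hp : p.Prime) {F : Type*} [Field F]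
    (hodd : p ≠ 2 → ∃ ζ : F, IsPrimitiveRoot ζ p)
    (htwo : p = 2 → ∃ ζ : F, IsPrimitiveRoot ζ 4)
    {S : Type*} [Group S] [TopologicalSpace S] [IsTopologicalGroup S]
    {I : Type*} (x : S) (y : I → S) (π : S →ₜ* GaloisProP p F)
    (hπ : IsMinimalPresentation p (adjoinFamily x y) π) :
    ¬ ∃ (l : ℕ) (u : ℤ) (s : S), 1 ≤ l ∧ Int.gcd (p : ℤ) u = 1 ∧
      s ∈ closedSubgroupClosure (Set.range y) ∧
      x ^ ((p : ℤ) ^ l * u) * s ∈ (π : S →* GaloisProP p F).ker := by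
  rintro ⟨l, u, s, -, hu, hs, hker⟩
  have hm : (p : ℤ) ^ l * u ≠ 0 := mul_ne_zero (pow_ne_zero l (mod_cast hp.ne_zero)) fun h =>
    hp.ne_one (by simpa [h] using hu)
  rw [← adjoinFamily_image_compl_none x] at hs
  exact theorem3p8_general hp hodd htwo hπ.minimal none hm hs hker
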